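/- For $n\ge 0$ let $d_n$ be the number of permutations $\pi=\pi_1\cdots\pi_n$ of $\{1,\dots,n\}$ that contain exactly one occurrence of the pattern 1-2-3 (positions $i<j<k$ with $\pi_i<\pi_j<\pi_k$) and no occurrence of the pattern 1-23 (positions $i<j$ with $\pi_i<\pi_j<\pi_{j+1}$). Let $C(x)=\frac{1-\sqrt{1-4x}}{2x}=\sum_{n\ge 0}\frac{1}{n+1}\binom{2n}{n}x^n$ be the Catalan generating function. Then, as formal power series, $$\sum_{n\ge 0} d_n x^n = x^4 C(x)^7,$$ and for every $n\ge 1$ $$d_n=\frac{7}{n+3}\binom{2n-2}{n+2}.$$ In particular $d_n=0$ for $n<4$, so that $\sum_{n\ge 4} d_n x^n = x^4C(x)^7=\sum_{n\ge 4}\frac{7}{n+3}\binom{2n-2}{n+2}x^n$. -/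

import Mathlib

/-- The occurrences of the classical pattern 1-2-3 in a permutation `π` of length `n` (written in
one-line notation `π 0, π 1, …, π (n - 1)`): the triples of positions `i < j < k` whose entries
are increasing. -/
def occurrences123 {n : ℕ} (π : Equiv.Perm (Fin n)) : Finset (Fin n × Fin n × Fin n) :=
  Finset.univ.filter fun t =>
    t.1 < t.2.1 ∧ t.2.1 < t.2.2 ∧ π t.1 < π t.2.1 ∧ π t.2.1 < π t.2.2

/-- The occurrences of the pattern 1-23 in `π`: the triples of positions `i < j < k` whose entries
are increasing and for which the last two positions `j`, `k` are adjacent. -/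
def occurrences1d23 {n : ℕ} (π : Equiv.Perm (Fin n)) : Finset (Fin n × Fin n × Fin n) :=
  Finset.univ.filter fun t =>
    t.1 < t.2.1 ∧ (t.2.2 : ℕ) = (t.2.1 : ℕ) + 1 ∧ π t.1 < π t.2.1 ∧ π t.2.1 < π t.2.2

/-- The number `d n` of permutations of length `n` with exactly one occurrence of 1-2-3 and no
occurrence of 1-23. -/
def dCount (n : ℕ) : ℕ :=
  (Finset.univ.filter fun π : Equiv.Perm (Fin n) =>
    (occurrences123 π).card = 1 ∧ (occurrences1d23 π).card = 0).card

/-- The Catalan generating function `C(x) = ∑ C_n x ^ n`, as a formal power series over `ℚ`. -/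
noncomputable def catalanGF : PowerSeries ℚ :=
  PowerSeries.map (Nat.castRingHom ℚ) PowerSeries.catalanSeries

/-! Let the unique 1-2-3 occurrence sit at positions `i < p < k`, all counted from 0, with `n = p +
q + 1`. A second entry left of `p` and below the middle entry, or a second one right of `p` and
above it, would give another occurrence. Hence exactly `p` entries exceed the middle one, whose
value is `q`, and the permutation splits into two 1-2-3-avoiders meeting at that entry. The upper
one, of length `p + 1`, does not end in its minimum; the lower one, of length `q + 1`, does not
begin with its maximum. Avoiding 1-23 means `k ≠ p + 1`, so the lower maximum is not second either.
Gluing inverts the splitting (`card_hasUniqueMiddle`).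

Both families are counted by building 1-2-3-avoiders through insertion of the maximum while tracking
a decreasing prefix, which gives coefficients of powers of `C` (`avoidPrefixCount_eq_coeff`). The
factors are `X * C ^ 3` and `X ^ 2 * C ^ 4`; the shared middle entry contributes one more `X`, and
the product is `X ^ 4 * C ^ 7`. -/

/-! ### Coefficients of powers of the Catalan series. -/

open PowerSeries in
theorem catalanGF_pow_succ (k : ℕ) :
    catalanGF ^ (k + 1) = catalanGF ^ k + X * catalanGF ^ (k + 2) := by
  have h : catalanGF = catalanGF ^ 2 * X + 1 := by
    have := congrArg (PowerSeries.map (Nat.castRingHom ℚ)) catalanSeries_sq_mul_X_add_one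
    simpa [catalanGF] using this.symm
  calc catalanGF ^ (k + 1) = catalanGF ^ k * catalanGF := pow_succ _ _
    _ = catalanGF ^ k * (catalanGF ^ 2 * X + 1) := by rw [← h]
    _ = _ := by ring

theorem coeff_zero_catalanGF_pow (k : ℕ) : PowerSeries.coeff 0 (catalanGF ^ k) = 1 := by
  have h : PowerSeries.constantCoeff catalanGF = 1 := by
    rw [← PowerSeries.coeff_zero_eq_constantCoeff_apply, catalanGF, PowerSeries.coeff_map]
    simp
  simp [h]

theorem coeff_succ_catalanGF_pow_succ (n k : ℕ) :
    PowerSeries.coeff (n + 1) (catalanGF ^ (k + 1)) =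
      PowerSeries.coeff (n + 1) (catalanGF ^ k) + PowerSeries.coeff n (catalanGF ^ (k + 2)) := by
  rw [catalanGF_pow_succ, map_add, PowerSeries.coeff_succ_X_mul]

/-- Double induction along `C ^ (k + 1) = C ^ k + X * C ^ (k + 2)`. The factor `2 * n + k` stays on
the left because it vanishes at `n = k = 0`. -/
theorem coeff_catalanGF_pow (n k : ℕ) :
    PowerSeries.coeff n (catalanGF ^ k) * (2 * n + k : ℚ) = k * ((2 * n + k).choose n : ℚ) := by
  induction n generalizing k with
  | zero => simp [coeff_zero_catalanGF_pow]
  | succ n ihn =>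
    induction k with
    | zero => simp
    | succ k ihk =>
      have h2 := ihn (k + 2)
      rw [coeff_succ_catalanGF_pow_succ]
      set a := PowerSeries.coeff (n + 1) (catalanGF ^ k)
      set b := PowerSeries.coeff n (catalanGF ^ (k + 2))
      rw [show 2 * (n + 1) + (k + 1) = (2 * n + k + 2) + 1 by ring, Nat.choose_succ_succ]
      rw [show 2 * (n + 1) + k = 2 * n + k + 2 by ring] at ihk
      rw [show 2 * n + (k + 2) = 2 * n + k + 2 by ring] at h2
      have h3 := Nat.choose_succ_right_eq (2 * n + k + 2) n
      rw [show 2 * n + k + 2 - n = n + k + 2 by omega] at h3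
      have h4 : ((2 * n + k + 2).choose (n + 1) : ℚ) * (n + 1) =
          (2 * n + k + 2).choose n * (n + k + 2) := by exact_mod_cast h3
      push_cast at ihk h2 ⊢
      set u : ℚ := ((2 * n + k + 2).choose n : ℚ)
      set v : ℚ := ((2 * n + k + 2).choose (n + 1) : ℚ)
      have hn : (n + 1 : ℚ) ≠ 0 := by positivity
      have hN : (2 * n + k + 2 : ℚ) ≠ 0 := by positivity
      have hv : v = u * (n + k + 2) / (n + 1) := by rw [eq_div_iff hn, h4]
      have ha : a = k * v / (2 * n + k + 2) := by
        rw [eq_div_iff hN, ← ihk]; ring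
      have hb : b = (k + 2) * u / (2 * n + k + 2) := by
        rw [eq_div_iff hN, ← h2]; ring
      rw [ha, hb, hv]
      field_simp
      ring

/-- Iterating `C ^ (k + 1) = C ^ k + X C ^ (k + 2)` down to the constant coefficient. -/
theorem sum_coeff_catalanGF_pow (d k : ℕ) :
    ∑ i ∈ Finset.range (d + 1), PowerSeries.coeff (d - i) (catalanGF ^ (k + i + 1)) =
      PowerSeries.coeff d (catalanGF ^ (k + 2)) := by
  induction d generalizing k with
  | zero => simp [coeff_zero_catalanGF_pow]
  | succ d ih =>
    rw [Finset.sum_range_succ', coeff_succ_catalanGF_pow_succ, add_comm, ← ih (k + 1)]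
    congr 1
    refine Finset.sum_congr rfl fun i _ => ?_
    rw [show d + 1 - (i + 1) = d - i by omega, show k + (i + 1) + 1 = k + 1 + i + 1 by ring]

theorem coeff_X_pow_four_mul_catalanGF_pow_seven {n : ℕ} (hn : 1 ≤ n) :
    PowerSeries.coeff n (PowerSeries.X ^ 4 * catalanGF ^ 7) =
      7 / ((n : ℚ) + 3) * ((2 * n - 2).choose (n + 2) : ℚ) := by
  rw [PowerSeries.coeff_X_pow_mul']
  split_ifs with h
  · obtain ⟨m, rfl⟩ := Nat.exists_eq_add_of_le' h
    have h1 := coeff_catalanGF_pow m 7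
    rw [Nat.add_sub_cancel, show 2 * (m + 4) - 2 = 2 * m + 6 by omega,
      show m + 4 + 2 = 2 * m + 6 - m by omega, Nat.choose_symm (by omega)]
    have h2 := Nat.choose_mul_succ_eq (2 * m + 6) m
    rw [show 2 * m + 6 + 1 - m = m + 7 by omega] at h2
    have h3 : ((2 * m + 6).choose m : ℚ) * (2 * m + 7) = (2 * m + 7).choose m * (m + 7) := by
      exact_mod_cast h2
    push_cast at h1 ⊢
    have hm : (m + 7 : ℚ) ≠ 0 := by positivity
    have hN : (2 * m + 7 : ℚ) ≠ 0 := by positivity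
    rw [← mul_left_inj' hN, h1, show (m : ℚ) + 4 + 3 = m + 7 by ring, mul_assoc, h3]
    field_simp
  -- For `n < 4` the lower index `n + 2` exceeds `2 * n - 2`.
  · rw [Nat.choose_eq_zero_of_lt (by omega)]
    simp

/-! ### Counting 1-2-3-avoiders by inserting the maximum. -/

/-- `σ` avoids the classical pattern 1-2-3. -/
def Avoids123 {n : ℕ} (σ : Equiv.Perm (Fin n)) : Prop :=
  ∀ i j k, i < j → j < k → σ i < σ j → ¬ σ j < σ k

/-- The first `k` entries of `σ` are decreasing. -/
def DecreasingPrefix {n : ℕ} (k : ℕ) (σ : Equiv.Perm (Fin n)) : Prop :=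
  ∀ i j : Fin n, i < j → (j : ℕ) < k → σ j < σ i

/-- Insert a new largest entry into `σ`, at position `p`. -/
def insertMax {n : ℕ} (p : Fin (n + 1)) (σ : Equiv.Perm (Fin n)) : Equiv.Perm (Fin (n + 1)) :=
  (finSuccEquiv' p).trans ((Equiv.optionCongr σ).trans (finSuccEquiv' (Fin.last n)).symm)

section

variable {n : ℕ} (p : Fin (n + 1)) (σ : Equiv.Perm (Fin n))

@[simp]
theorem insertMax_self : insertMax p σ p = Fin.last n := by
  simp [insertMax]

@[simp]
theorem insertMax_succAbove (i : Fin n) : insertMax p σ (p.succAbove i) = (σ i).castSucc := by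
  simp [insertMax]

theorem insertMax_symm_last : (insertMax p σ).symm (Fin.last n) = p := by
  rw [Equiv.symm_apply_eq, insertMax_self]

end

theorem insertMax_bijective (n : ℕ) :
    Function.Bijective fun x : Fin (n + 1) × Equiv.Perm (Fin n) => insertMax x.1 x.2 := by
  rw [Fintype.bijective_iff_injective_and_card]
  constructor
  · rintro ⟨p, σ⟩ ⟨p', σ'⟩ h
    have hp : p = p' := by
      rw [← insertMax_symm_last p σ, ← insertMax_symm_last p' σ']
      exact congrArg (fun τ : Equiv.Perm (Fin (n + 1)) => τ.symm (Fin.last n)) h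
    subst hp
    congr 1
    ext i
    have := congrArg (fun τ : Equiv.Perm (Fin (n + 1)) => τ (p.succAbove i)) h
    simpa [Fin.ext_iff] using this
  · simp [Fintype.card_perm, Nat.factorial_succ]

theorem card_filter_perm_succ {n : ℕ} (P : Equiv.Perm (Fin (n + 1)) → Prop) [DecidablePred P] :
    (Finset.univ.filter P).card =
      ∑ p : Fin (n + 1), (Finset.univ.filter fun σ : Equiv.Perm (Fin n) => P (insertMax p σ)).card := by
  simp only [Finset.card_filter]
  rw [← Fintype.sum_prod_type' (fun (p : Fin (n + 1)) (σ : Equiv.Perm (Fin n)) =>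
    if P (insertMax p σ) then 1 else 0)]
  exact (Function.Bijective.sum_comp (insertMax_bijective n) (fun π => if P π then 1 else 0)).symm

/-- The new maximum can only play the role of 3, so it creates an occurrence exactly when some
increasing pair precedes it. -/
theorem avoids123_insertMax {n : ℕ} (p : Fin (n + 1)) (σ : Equiv.Perm (Fin n)) :
    Avoids123 (insertMax p σ) ↔ Avoids123 σ ∧ DecreasingPrefix p σ := by
  constructor
  · intro h
    refine ⟨fun i j k hij hjk h1 h2 => ?_, fun i j hij hj => ?_⟩
    · refine h (p.succAbove i) (p.succAbove j) (p.succAbove k) ?_ ?_ ?_ ?_ <;>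
        simpa [Fin.succAbove_lt_succAbove_iff]
    · by_contra hlt
      have hlt : σ i < σ j := lt_of_le_of_ne (not_lt.1 hlt) fun h => hij.ne (σ.injective h)
      refine h (p.succAbove i) (p.succAbove j) p ?_ ?_ ?_ ?_
      · simpa
      · rw [Fin.succAbove_lt_iff_castSucc_lt]
        exact hj
      · simpa
      · simp
  · rintro ⟨h, hd⟩ i j k hij hjk h1 h2
    have hne : ∀ x y, insertMax p σ x < insertMax p σ y → x ≠ p := by
      rintro x y hxy rfl
      rw [insertMax_self] at hxy
      exact absurd hxy (not_lt.2 (Fin.le_last _))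
    obtain ⟨i, rfl⟩ := Fin.exists_succAbove_eq (hne _ _ h1)
    obtain ⟨j, rfl⟩ := Fin.exists_succAbove_eq (hne _ _ h2)
    simp only [insertMax_succAbove, Fin.castSucc_lt_castSucc_iff,
      Fin.succAbove_lt_succAbove_iff] at h1 hij
    by_cases hk : k = p
    · subst hk
      rw [Fin.succAbove_lt_iff_castSucc_lt] at hjk
      exact absurd h1 (not_lt.2 (hd i j hij hjk).le)
    · obtain ⟨k, rfl⟩ := Fin.exists_succAbove_eq hk
      simp only [insertMax_succAbove, Fin.castSucc_lt_castSucc_iff,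
        Fin.succAbove_lt_succAbove_iff] at h2 hjk
      exact h i j k hij hjk h1 h2

theorem decreasingPrefix_of_le_one {n k : ℕ} (hk : k ≤ 1) (σ : Equiv.Perm (Fin n)) :
    DecreasingPrefix k σ := by
  intro i j hij hj
  have : (i : ℕ) < j := hij
  omega

theorem DecreasingPrefix.mono {n k l : ℕ} {σ : Equiv.Perm (Fin n)} (h : DecreasingPrefix l σ)
    (hkl : k ≤ l) : DecreasingPrefix k σ :=
  fun i j hij hj => h i j hij (hj.trans_le hkl)

theorem decreasingPrefix_insertMax_zero {n k : ℕ} (σ : Equiv.Perm (Fin n)) :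
    DecreasingPrefix (k + 1) (insertMax 0 σ) ↔ DecreasingPrefix k σ := by
  constructor
  · intro h i j hij hj
    have := h ((0 : Fin (n + 1)).succAbove i) ((0 : Fin (n + 1)).succAbove j) (by simpa)
      (by simpa using hj)
    simpa only [insertMax_succAbove, Fin.castSucc_lt_castSucc_iff] using this
  · intro h i j hij hj
    obtain ⟨j, rfl⟩ := Fin.exists_succAbove_eq (Fin.ne_zero_of_lt hij)
    by_cases hi : i = 0
    · subst hi
      simp only [insertMax_self, insertMax_succAbove]
      exact Fin.castSucc_lt_last _
    · obtain ⟨i, rfl⟩ := Fin.exists_succAbove_eq hi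
      simp only [insertMax_succAbove, Fin.castSucc_lt_castSucc_iff]
      refine h i j ?_ ?_
      · simpa using hij
      · simpa using hj

theorem decreasingPrefix_insertMax_of_ne_zero {n k : ℕ} {p : Fin (n + 1)} (hp : p ≠ 0)
    (σ : Equiv.Perm (Fin n)) :
    DecreasingPrefix k (insertMax p σ) ↔ k ≤ p ∧ DecreasingPrefix k σ := by
  have hp' : 0 < (p : ℕ) := Fin.pos_iff_ne_zero.2 hp
  constructor
  · intro h
    have hk : k ≤ p := by
      by_contra! hk
      refine absurd (h 0 p (Fin.pos_iff_ne_zero.2 hp) hk) ?_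
      rw [insertMax_self]
      exact not_lt.2 (Fin.le_last _)
    refine ⟨hk, fun i j hij hj => ?_⟩
    have hjp : p.succAbove j = j.castSucc :=
      Fin.succAbove_of_castSucc_lt _ _ (by simp [Fin.lt_def]; omega)
    have := h (p.succAbove i) (p.succAbove j) (by simpa) (by rw [hjp]; exact hj)
    simpa only [insertMax_succAbove, Fin.castSucc_lt_castSucc_iff] using this
  · rintro ⟨hk, h⟩ i j hij hj
    have hjp : j < p := Fin.lt_def.2 (hj.trans_le hk)
    obtain ⟨j, rfl⟩ := Fin.exists_succAbove_eq hjp.ne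
    obtain ⟨i, rfl⟩ := Fin.exists_succAbove_eq (hij.trans hjp).ne
    simp only [insertMax_succAbove, Fin.castSucc_lt_castSucc_iff,
      Fin.succAbove_lt_succAbove_iff] at hij ⊢
    rw [Fin.succAbove_lt_iff_castSucc_lt] at hjp
    rw [Fin.succAbove_of_castSucc_lt _ _ hjp] at hj
    exact h i j hij hj

open Classical in
/-- The number of permutations of length `n` that avoid 1-2-3 and begin with `k` decreasing
entries. -/
noncomputable def avoidPrefixCount (n k : ℕ) : ℕ :=
  (Finset.univ.filter fun σ : Equiv.Perm (Fin n) => Avoids123 σ ∧ DecreasingPrefix k σ).card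

/-- Inserting the maximum in front lengthens a decreasing prefix by one: the term `i = 0`. At a
position `p > 0` the prefix must stop before it, so `k + 1 ≤ p`, and avoidance then asks for the
longer prefix `p = k + i`. -/
theorem avoidPrefixCount_succ_succ (n k : ℕ) :
    avoidPrefixCount (n + 1) (k + 1) =
      ∑ i ∈ Finset.range (n - k + 1), avoidPrefixCount n (k + i) := by
  classical
  rw [avoidPrefixCount, card_filter_perm_succ, Fin.sum_univ_succ]
  have h0 : (Finset.univ.filter fun σ : Equiv.Perm (Fin n) =>
      Avoids123 (insertMax 0 σ) ∧ DecreasingPrefix (k + 1) (insertMax 0 σ)).card =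
      avoidPrefixCount n k := by
    rw [avoidPrefixCount]
    congr 1
    ext σ
    simp only [Finset.mem_filter, Finset.mem_univ, true_and, avoids123_insertMax,
      decreasingPrefix_insertMax_zero]
    have := decreasingPrefix_of_le_one (Nat.zero_le 1) σ
    simp only [Fin.val_zero]
    tauto
  have h1 : ∀ p : Fin n, (Finset.univ.filter fun σ : Equiv.Perm (Fin n) =>
      Avoids123 (insertMax p.succ σ) ∧ DecreasingPrefix (k + 1) (insertMax p.succ σ)).card =
      if k ≤ p then avoidPrefixCount n (p + 1) else 0 := by
    intro p
    simp only [avoids123_insertMax, decreasingPrefix_insertMax_of_ne_zero (Fin.succ_ne_zero p),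
      Fin.val_succ]
    split_ifs with hp
    · rw [avoidPrefixCount]
      congr 1
      ext σ
      simp only [Finset.mem_filter, Finset.mem_univ, true_and]
      have := fun h : DecreasingPrefix (p + 1) σ => h.mono (Nat.add_le_add_right hp 1)
      have := Nat.add_le_add_right hp 1
      tauto
    · rw [Finset.card_eq_zero, Finset.filter_eq_empty_iff]
      intro σ _
      omega
  rw [h0, Finset.sum_congr rfl fun p _ => h1 p,
    Fin.sum_univ_eq_sum_range (fun p => if k ≤ p then avoidPrefixCount n (p + 1) else 0),
    Finset.sum_range_succ']
  rw [add_comm, ← Finset.sum_filter]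
  congr 1
  have : (Finset.range n).filter (fun p => k ≤ p) = Finset.Ico k n := by
    ext; simp [and_comm]
  rw [this, Finset.sum_Ico_eq_sum_range]
  exact Finset.sum_congr rfl fun i _ => by rw [add_assoc]

theorem avoidPrefixCount_zero_eq_one (n : ℕ) : avoidPrefixCount n 0 = avoidPrefixCount n 1 := by
  unfold avoidPrefixCount
  congr 1
  ext σ
  simp [decreasingPrefix_of_le_one]

theorem avoidPrefixCount_eq_coeff (n k : ℕ) (hk : k ≤ n) :
    (avoidPrefixCount n k : ℚ) = PowerSeries.coeff (n - k) (catalanGF ^ (k + 1)) := by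
  induction n generalizing k with
  | zero =>
    obtain rfl : k = 0 := by omega
    have : ∀ σ : Equiv.Perm (Fin 0), Avoids123 σ := fun σ i => i.elim0
    rw [Nat.sub_zero, coeff_zero_catalanGF_pow]
    simp [avoidPrefixCount, this, decreasingPrefix_of_le_one]
  | succ n ih =>
    have key : ∀ k ≤ n, (avoidPrefixCount (n + 1) (k + 1) : ℚ) =
        PowerSeries.coeff (n - k) (catalanGF ^ (k + 2)) := by
      intro k hk
      rw [avoidPrefixCount_succ_succ, Nat.cast_sum, ← sum_coeff_catalanGF_pow]
      refine Finset.sum_congr rfl fun i hi => ?_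
      rw [Finset.mem_range] at hi
      rw [ih _ (by omega), Nat.sub_sub]
    cases k with
    | zero =>
      -- A prefix of length 1 is no condition; the two coefficients agree because `C ^ 0` has none
      -- in positive degree.
      rw [avoidPrefixCount_zero_eq_one, key 0 (Nat.zero_le _), Nat.sub_zero, Nat.sub_zero,
        coeff_succ_catalanGF_pow_succ]
      simp
    | succ k =>
      rw [key k (by omega), Nat.add_sub_add_right]

open Classical in
/-- The number of permutations of length `n + 1` that avoid 1-2-3 and whose largest entry has at
least `k` entries to its left. -/
theorem card_avoids123_le_symm_last (n k : ℕ) :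
    ((Finset.univ.filter fun σ : Equiv.Perm (Fin (n + 1)) =>
      Avoids123 σ ∧ k ≤ (σ.symm (Fin.last n) : ℕ)).card : ℚ) =
      PowerSeries.coeff n (PowerSeries.X ^ k * catalanGF ^ (k + 2)) := by
  have h1 : ∀ p : Fin (n + 1), (Finset.univ.filter fun σ : Equiv.Perm (Fin n) =>
      Avoids123 (insertMax p σ) ∧ k ≤ ((insertMax p σ).symm (Fin.last n) : ℕ)).card =
      if k ≤ p then avoidPrefixCount n p else 0 := by
    intro p
    simp only [avoids123_insertMax, insertMax_symm_last]
    split_ifs with hp <;> simp [hp, avoidPrefixCount]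
  rw [card_filter_perm_succ, Finset.sum_congr rfl fun p _ => h1 p,
    Fin.sum_univ_eq_sum_range (fun p => if k ≤ p then avoidPrefixCount n p else 0),
    ← Finset.sum_filter, PowerSeries.coeff_X_pow_mul']
  have : (Finset.range (n + 1)).filter (fun p => k ≤ p) = Finset.Ico k (n + 1) := by
    ext; simp [and_comm]
  rw [this, Finset.sum_Ico_eq_sum_range]
  split_ifs with hk
  · rw [Nat.cast_sum, ← sum_coeff_catalanGF_pow, show n + 1 - k = n - k + 1 by omega]
    refine Finset.sum_congr rfl fun i hi => ?_
    rw [Finset.mem_range] at hi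
    rw [avoidPrefixCount_eq_coeff _ _ (by omega), Nat.sub_sub]
  · rw [show n + 1 - k = 0 by omega]
    simp

theorem avoids123_revPerm_conj {n : ℕ} (σ : Equiv.Perm (Fin n)) (h : Avoids123 σ) :
    Avoids123 (Fin.revPerm * σ * Fin.revPerm) := by
  intro i j k hij hjk h1 h2
  simp only [Equiv.Perm.mul_apply, Fin.revPerm_apply, Fin.rev_lt_rev] at h1 h2
  exact h k.rev j.rev i.rev (Fin.rev_lt_rev.2 hjk) (Fin.rev_lt_rev.2 hij) h2 h1

open Classical in
-- Reverse-complement preserves avoidance and exchanges "minimum not last" with "maximum not first",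
-- the case `k = 1` of `card_avoids123_le_symm_last`.
theorem card_avoids123_last_ne_zero (n : ℕ) :
    ((Finset.univ.filter fun σ : Equiv.Perm (Fin (n + 1)) =>
      Avoids123 σ ∧ σ (Fin.last n) ≠ 0).card : ℚ) =
      PowerSeries.coeff n (PowerSeries.X * catalanGF ^ 3) := by
  have h := card_avoids123_le_symm_last n 1
  rw [pow_one] at h
  rw [← h]
  congr 1
  let e : Equiv.Perm (Fin (n + 1)) → Equiv.Perm (Fin (n + 1)) :=
    fun σ => Fin.revPerm * σ * Fin.revPerm
  have he : ∀ σ, e (e σ) = σ := by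
    intro σ
    ext i
    simp [e]
  have hl : ∀ σ : Equiv.Perm (Fin (n + 1)),
      1 ≤ ((e σ).symm (Fin.last n) : ℕ) ↔ σ (Fin.last n) ≠ 0 := by
    intro σ
    rw [Nat.one_le_iff_ne_zero, ne_eq, Fin.val_eq_zero_iff, Equiv.symm_apply_eq, not_iff_not]
    simp only [e, Equiv.Perm.mul_apply, Fin.revPerm_apply, Fin.rev_zero]
    rw [eq_comm, Fin.rev_eq_iff, Fin.rev_last]
  refine Finset.card_bij' (fun σ _ => e σ) (fun σ _ => e σ) ?_ ?_ (fun σ _ => he σ)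
    (fun σ _ => he σ)
  · intro σ hσ
    simp only [Finset.mem_filter, Finset.mem_univ, true_and] at hσ ⊢
    exact ⟨avoids123_revPerm_conj σ hσ.1, (hl σ).2 hσ.2⟩
  · intro σ hσ
    simp only [Finset.mem_filter, Finset.mem_univ, true_and] at hσ ⊢
    exact ⟨avoids123_revPerm_conj σ hσ.1, (hl _).1 (by rw [he]; exact hσ.2)⟩

/-! ### Permutations as functions on the natural numbers. -/

/-- The one-line notation of `σ` as a function on `ℕ`, extended by zero. -/
def natFun {n : ℕ} (σ : Equiv.Perm (Fin n)) (x : ℕ) : ℕ :=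
  if h : x < n then σ ⟨x, h⟩ else 0

/-- The permutation whose one-line notation is given by `f`. -/
noncomputable def permOfNatFun {n : ℕ} (f : ℕ → ℕ) (hf : ∀ x < n, f x < n)
    (hinj : ∀ x < n, ∀ y < n, f x = f y → x = y) : Equiv.Perm (Fin n) :=
  Equiv.ofBijective (fun x : Fin n => (⟨f x, hf x x.2⟩ : Fin n))
    (Finite.injective_iff_bijective.1 fun x y h =>
      Fin.ext (hinj x x.2 y y.2 (congrArg Fin.val h)))

section

variable {n : ℕ} (σ : Equiv.Perm (Fin n))

theorem natFun_val (i : Fin n) : natFun σ i = σ i := by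
  simp [natFun]

theorem natFun_lt {x : ℕ} (hx : x < n) : natFun σ x < n := by
  simp [natFun, hx]

theorem natFun_inj {x y : ℕ} (hx : x < n) (hy : y < n) (h : natFun σ x = natFun σ y) : x = y := by
  simpa [natFun, hx, hy, Fin.val_inj] using h

theorem exists_natFun_eq {v : ℕ} (hv : v < n) : ∃ x < n, natFun σ x = v :=
  ⟨σ.symm ⟨v, hv⟩, (σ.symm ⟨v, hv⟩).2, by simp [natFun_val]⟩

theorem natFun_permOfNatFun {f : ℕ → ℕ} (hf : ∀ x < n, f x < n)
    (hinj : ∀ x < n, ∀ y < n, f x = f y → x = y) {x : ℕ} (hx : x < n) :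
    natFun (permOfNatFun f hf hinj) x = f x := by
  simp [natFun, permOfNatFun, hx]

variable {σ}

theorem perm_eq_of_natFun_eq {τ : Equiv.Perm (Fin n)}
    (h : ∀ x < n, natFun σ x = natFun τ x) : σ = τ := by
  ext i
  rw [← natFun_val, ← natFun_val, h i i.2]

/-- Two permutations that agree off one point are equal. -/
theorem perm_eq_of_natFun_eq_off {τ : Equiv.Perm (Fin n)} (a : ℕ)
    (h : ∀ x < n, x ≠ a → natFun σ x = natFun τ x) : σ = τ := by
  refine perm_eq_of_natFun_eq fun x hx => ?_
  by_cases hxa : x = a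
  · subst hxa
    obtain ⟨y, hy, hyx⟩ := exists_natFun_eq σ (natFun_lt τ hx)
    by_cases hxy : y = x
    · rw [← hxy, hyx, hxy]
    · rw [h y hy hxy] at hyx
      exact absurd (natFun_inj τ hy hx hyx) hxy
  · exact h x hx hxa

theorem avoids123_iff_natFun : Avoids123 σ ↔ ∀ x y z, x < y → y < z → z < n →
    natFun σ x < natFun σ y → ¬ natFun σ y < natFun σ z := by
  constructor
  · intro h x y z hxy hyz hz
    have hy := hyz.trans hz
    have := h ⟨x, hxy.trans hy⟩ ⟨y, hy⟩ ⟨z, hz⟩ hxy hyz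
    simpa only [natFun, dif_pos hz, dif_pos hy, dif_pos (hxy.trans hy), Fin.lt_def] using this
  · intro h i j k hij hjk
    have := h i j k hij hjk k.2
    simpa only [natFun_val, Fin.lt_def] using this

end

/-! ### Splitting and gluing at the middle entry. -/

/-- The positions `i < p < k` carry the only 1-2-3 occurrence of `f` restricted to `[0, n)`. -/
def IsUniqueOccurrence (n : ℕ) (f : ℕ → ℕ) (i p k : ℕ) : Prop :=
  i < p ∧ p < k ∧ k < n ∧ f i < f p ∧ f p < f k ∧
    ∀ x y z, x < y → y < z → z < n → f x < f y → f y < f z → x = i ∧ y = p ∧ z = k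

/-- `π` has a unique 1-2-3 occurrence, its middle entry is at position `p`, and the last two
entries of the occurrence are not adjacent. -/
def HasUniqueMiddle {n : ℕ} (p : ℕ) (π : Equiv.Perm (Fin n)) : Prop :=
  ∃ i k, k ≠ p + 1 ∧ IsUniqueOccurrence n (natFun π) i p k

/-- Glue a word of length `p + 1` above a word of length `q + 1`: they share the middle entry `q`
at position `p`, the smallest entry of the upper word is replaced by the first entry of the lower
one, and the largest entry of the lower word by the last entry of the upper one. -/
def glueFun (p q : ℕ) (s t : ℕ → ℕ) (x : ℕ) : ℕ :=
  if x < p then (if s x = 0 then t 0 else q + s x)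
  else if x = p then q
  else if t (x - p) = q then q + s p else t (x - p)

section

variable {p q : ℕ} {σ : Equiv.Perm (Fin (p + 1))} {τ : Equiv.Perm (Fin (q + 1))}

theorem glueFun_lt {x : ℕ} (hx : x < p + q + 1) :
    glueFun p q (natFun σ) (natFun τ) x < p + q + 1 := by
  have h0 := natFun_lt τ (Nat.succ_pos q)
  have hp := natFun_lt σ (Nat.lt_succ_self p)
  unfold glueFun
  split_ifs with h1 h2 h3 h4
  · omega
  · have := natFun_lt σ (show x < p + 1 by omega)
    omega
  · omega
  · omega
  · have := natFun_lt τ (show x - p < q + 1 by omega)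
    omega

theorem glueFun_inj (hσ : natFun σ p ≠ 0) (hτ : natFun τ 0 ≠ q) :
    ∀ x < p + q + 1, ∀ y < p + q + 1,
      glueFun p q (natFun σ) (natFun τ) x = glueFun p q (natFun σ) (natFun τ) y → x = y := by
  suffices H : ∀ x y, x < y → y < p + q + 1 →
      glueFun p q (natFun σ) (natFun τ) x ≠ glueFun p q (natFun σ) (natFun τ) y by
    intro x hx y hy h
    rcases lt_trichotomy x y with hxy | hxy | hxy
    · exact absurd h (H x y hxy hy)
    · exact hxy
    · exact absurd h.symm (H y x hxy hx)
  intro x y hxy hy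
  have h0 := natFun_lt τ (Nat.succ_pos q)
  have i1 := fun (hx : x < p + 1) (hy : y < p + 1) => natFun_inj σ hx hy
  have i2 := fun hx : x < p + 1 => natFun_inj σ hx (Nat.lt_succ_self p)
  have i3 := fun (hx : x - p < q + 1) (hy : y - p < q + 1) => natFun_inj τ hx hy
  have i4 := fun hy : y - p < q + 1 => natFun_inj τ hy (Nat.succ_pos q)
  have b1 := fun hx : x - p < q + 1 => natFun_lt τ hx
  have b2 := fun hy : y - p < q + 1 => natFun_lt τ hy
  unfold glueFun
  split_ifs <;> omega

/-- The permutation glued from `σ` and `τ`. -/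
noncomputable def gluePerm (σ : Equiv.Perm (Fin (p + 1))) (τ : Equiv.Perm (Fin (q + 1)))
    (hσ : natFun σ p ≠ 0) (hτ : natFun τ 0 ≠ q) : Equiv.Perm (Fin (p + q + 1)) :=
  permOfNatFun (glueFun p q (natFun σ) (natFun τ)) (fun _ hx => glueFun_lt hx) (glueFun_inj hσ hτ)

theorem natFun_gluePerm (hσ : natFun σ p ≠ 0) (hτ : natFun τ 0 ≠ q) {x : ℕ}
    (hx : x < p + q + 1) :
    natFun (gluePerm σ τ hσ hτ) x = glueFun p q (natFun σ) (natFun τ) x :=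
  natFun_permOfNatFun _ _ hx

/-- An occurrence with middle position before `p` would give one in `σ`, reading `p + k` as position
`p` of `σ`; one with middle position after `p` would give one in `τ`, reading `i` as position 0 of
`τ`. With middle `p`, only `i` is lower on the left and only `p + k` higher on the right. -/
theorem isUniqueOccurrence_glueFun (hσ : natFun σ p ≠ 0) (hτ : natFun τ 0 ≠ q)
    (hσa : Avoids123 σ) (hτa : Avoids123 τ) {i k : ℕ} (hi : i < p + 1) (hi0 : natFun σ i = 0)
    (hk : k < q + 1) (hkq : natFun τ k = q) :
    IsUniqueOccurrence (p + q + 1) (glueFun p q (natFun σ) (natFun τ)) i p (p + k) := by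
  rw [avoids123_iff_natFun] at hσa hτa
  have hip : i < p := lt_of_le_of_ne (Nat.lt_succ_iff.1 hi) (by rintro rfl; exact hσ hi0)
  have hk0 : 0 < k := Nat.pos_of_ne_zero (by rintro rfl; exact hτ hkq)
  have h0 := natFun_lt τ (Nat.succ_pos q)
  have gi : glueFun p q (natFun σ) (natFun τ) i = natFun τ 0 := by
    simp [glueFun, hip, hi0]
  have gp : glueFun p q (natFun σ) (natFun τ) p = q := by
    simp [glueFun]
  have gk : glueFun p q (natFun σ) (natFun τ) (p + k) = q + natFun σ p := by
    simp [glueFun, hkq, hk0.ne']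
  have gl : ∀ x < p, x ≠ i → glueFun p q (natFun σ) (natFun τ) x = q + natFun σ x ∧
      0 < natFun σ x := by
    intro x hx hxi
    have : natFun σ x ≠ 0 := fun h => hxi (natFun_inj σ (by omega) hi (h.trans hi0.symm))
    exact ⟨by simp [glueFun, hx, this], Nat.pos_of_ne_zero this⟩
  have gr : ∀ y, 0 < y → y < q + 1 → y ≠ k →
      glueFun p q (natFun σ) (natFun τ) (p + y) = natFun τ y ∧ natFun τ y < q := by
    intro y hy0 hy hyk
    have h1 : natFun τ y ≠ q := fun h => hyk (natFun_inj τ hy hk (h.trans hkq.symm))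
    have h2 := natFun_lt τ hy
    exact ⟨by simp [glueFun, hy0.ne', h1], by omega⟩
  refine ⟨hip, by omega, by omega, by omega, by omega, ?_⟩
  generalize glueFun p q (natFun σ) (natFun τ) = g at *
  intro x y z hxy hyz hz h1 h2
  rcases lt_trichotomy y p with hy | rfl | hy
  · exfalso
    have hx := gl x (by omega)
    have hy' := gl y hy
    have hxi : x = i → natFun σ x = 0 := by rintro rfl; exact hi0
    have hyi : y = i → g y = natFun τ 0 := by rintro rfl; exact gi
    have hxi' : x = i → g x = natFun τ 0 := by rintro rfl; exact gi
    rcases lt_trichotomy z p with hz' | rfl | hz'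
    · have hz'' := gl z hz'
      have hzi : z = i → g z = natFun τ 0 := by rintro rfl; exact gi
      have := hσa x y z hxy hyz (by omega)
      omega
    · omega
    · obtain ⟨w, rfl⟩ := Nat.exists_eq_add_of_le hz'.le
      have hw := gr w (by omega) (by omega)
      have hwk : w = k → g (p + w) = q + natFun σ p := by rintro rfl; exact gk
      have := hσa x y p hxy hy (by omega)
      omega
  · have hx := gl x hxy
    obtain ⟨w, rfl⟩ := Nat.exists_eq_add_of_le hyz.le
    have hw := gr w (by omega) (by omega)
    omega
  · exfalso
    obtain ⟨v, rfl⟩ := Nat.exists_eq_add_of_le hy.le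
    obtain ⟨w, rfl⟩ := Nat.exists_eq_add_of_le (hy.trans hyz).le
    have hv := gr v (by omega) (by omega)
    have hw := gr w (by omega) (by omega)
    have hvk : v = k → g (p + v) = q + natFun σ p := by rintro rfl; exact gk
    have hwk : w = k → g (p + w) = q + natFun σ p ∧ natFun τ w = q := by
      rintro rfl; exact ⟨gk, hkq⟩
    rcases lt_trichotomy x p with hx' | rfl | hx'
    · have hx := gl x hx'
      have hxi : x = i → g x = natFun τ 0 := by rintro rfl; exact gi
      have := hτa 0 v w (by omega) (by omega) (by omega)
      omega
    · omega
    · obtain ⟨u, rfl⟩ := Nat.exists_eq_add_of_le hx'.le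
      have hu := gr u (by omega) (by omega)
      have huk : u = k → g (p + u) = q + natFun σ p := by rintro rfl; exact gk
      have := hτa u v w (by omega) (by omega) (by omega)
      omega

/-- The glued word determines both of its parts. -/
theorem glueFun_cancel {σ' : Equiv.Perm (Fin (p + 1))} {τ' : Equiv.Perm (Fin (q + 1))}
    (h : ∀ x < p + q + 1, glueFun p q (natFun σ) (natFun τ) x =
      glueFun p q (natFun σ') (natFun τ') x) : σ = σ' ∧ τ = τ' := by
  have h0 := natFun_lt τ (Nat.succ_pos q)
  have h0' := natFun_lt τ' (Nat.succ_pos q)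
  constructor
  -- The glued entries before `p` show `σ` except at `p`, those after it show `τ` except at 0; one
  -- missing value is forced.
  · refine perm_eq_of_natFun_eq_off p fun x hx hxp => ?_
    have := h x (by omega)
    simp only [glueFun, show x < p by omega, if_true] at this
    split_ifs at this <;> omega
  · refine perm_eq_of_natFun_eq_off 0 fun y hy hy0 => ?_
    have := h (p + y) (by omega)
    have b1 := natFun_lt τ hy
    have b2 := natFun_lt τ' hy
    simp only [glueFun, show ¬ p + y < p by omega, show p + y ≠ p by omega, if_false,
      Nat.add_sub_cancel_left] at this
    split_ifs at this <;> omega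

end

section

variable {p q : ℕ} {π : Equiv.Perm (Fin (p + q + 1))} {i k : ℕ}

theorem IsUniqueOccurrence.lt_left (h : IsUniqueOccurrence (p + q + 1) (natFun π) i p k) {x : ℕ}
    (hx : x < p) (hxi : x ≠ i) : natFun π p < natFun π x := by
  obtain ⟨h1, h2, h3, h4, h5, h6⟩ := h
  by_contra hlt
  have := natFun_inj π (show x < p + q + 1 by omega) (show p < p + q + 1 by omega)
  have := h6 x p k hx h2 h3 (by omega) h5
  omega

theorem IsUniqueOccurrence.right_lt (h : IsUniqueOccurrence (p + q + 1) (natFun π) i p k) {x : ℕ}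
    (hx : p < x) (hxn : x < p + q + 1) (hxk : x ≠ k) : natFun π x < natFun π p := by
  obtain ⟨h1, h2, h3, h4, h5, h6⟩ := h
  by_contra hlt
  have := natFun_inj π hxn (show p < p + q + 1 by omega)
  have := h6 i p x h1 hx hxn h4 (by omega)
  omega

/-- Exactly `p` entries exceed the middle entry of the occurrence. -/
theorem IsUniqueOccurrence.middle_eq (h : IsUniqueOccurrence (p + q + 1) (natFun π) i p k) :
    natFun π p = q := by
  have hl := fun x => h.lt_left (x := x)
  have hr := fun x => h.right_lt (x := x)
  obtain ⟨h1, h2, h3, h4, h5, -⟩ := h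
  let P : Fin (p + q + 1) := ⟨p, by omega⟩
  let I : Fin (p + q + 1) := ⟨i, by omega⟩
  let K : Fin (p + q + 1) := ⟨k, h3⟩
  -- The larger entries sit at `k` and at the positions before `p` other than `i`. Counting both
  -- sides gives `p + q - π p = p`.
  have himg : Finset.Ioi (π P) = (insert K ((Finset.Iio P).erase I)).image π := by
    ext v
    obtain ⟨x, rfl⟩ := π.surjective v
    rw [π.injective.mem_finset_image]
    simp only [Finset.mem_Ioi, Finset.mem_insert, Finset.mem_erase, Finset.mem_Iio, Fin.lt_def,
      Fin.ext_iff, ne_eq, ← natFun_val π, P, I, K]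
    have hx1 := hl x
    have hx2 := hr x
    have hxi : (x : ℕ) = i → natFun π x = natFun π i := by intro h; rw [h]
    have hxk : (x : ℕ) = k → natFun π x = natFun π k := by intro h; rw [h]
    have hxp : (x : ℕ) = p → natFun π x = natFun π p := by intro h; rw [h]
    have := x.2
    omega
  have hcard := congrArg Finset.card himg
  rw [Finset.card_image_of_injective _ π.injective, Finset.card_insert_of_notMem,
    Finset.card_erase_of_mem, Fin.card_Ioi, Fin.card_Iio, ← natFun_val π] at hcard
  · have := natFun_lt π (show p < p + q + 1 by omega)
    simp only [P] at hcard
    omega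
  · simp [P, I, Fin.lt_def, h1]
  · simp [P, K, Fin.lt_def]
    omega

theorem IsUniqueOccurrence.exists_glue (h : IsUniqueOccurrence (p + q + 1) (natFun π) i p k)
    (hk : k ≠ p + 1) :
    ∃ (σ : Equiv.Perm (Fin (p + 1))) (τ : Equiv.Perm (Fin (q + 1))),
      Avoids123 σ ∧ natFun σ p ≠ 0 ∧ Avoids123 τ ∧ natFun τ 0 ≠ q ∧ natFun τ 1 ≠ q ∧
      ∀ x < p + q + 1, glueFun p q (natFun σ) (natFun τ) x = natFun π x := by
  have hm := h.middle_eq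
  have hl := fun x => h.lt_left (x := x)
  have hr := fun x => h.right_lt (x := x)
  obtain ⟨h1, h2, h3, h4, h5, h6⟩ := h
  have hlt := fun x (hx : x < p + q + 1) => natFun_lt π hx
  have hinj := fun x y (hx : x < p + q + 1) (hy : y < p + q + 1) => natFun_inj π hx hy
  generalize natFun π = f at *
  -- Truncated subtraction sends the low entry `f i` to 0, and `min` below caps the high entry `f k`
  -- at `q`: exactly the two replacements that `glueFun` undoes.
  let s : ℕ → ℕ := fun x => if x = p then f k - q else f x - q
  let t : ℕ → ℕ := fun y => if y = 0 then f i else min (f (p + y)) q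
  have hkn := hlt k h3
  have s_p : s p = f k - q := by simp [s]
  have s_i : s i = 0 := by
    have : i ≠ p := h1.ne
    simp only [s, this, if_false]
    omega
  have s_l : ∀ x < p, s x = f x - q := fun x hx => by simp [s, hx.ne]
  have t_0 : t 0 = f i := by simp [t]
  have t_r : ∀ y, 0 < y → t y = min (f (p + y)) q := fun y hy => by simp [t, hy.ne']
  have s_lt : ∀ x < p + 1, s x < p + 1 := by
    intro x hx
    have := hlt x (by omega)
    simp only [s]
    split_ifs <;> omega
  have t_lt : ∀ x < q + 1, t x < q + 1 := by
    intro x hx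
    simp only [t]
    split_ifs <;> omega
  have s_inj : ∀ x < p + 1, ∀ y < p + 1, s x = s y → x = y := by
    intro x hx y hy
    have a1 := hl x
    have a2 := hl y
    have a3 := hinj x y (by omega) (by omega)
    have a4 := hinj x k (by omega) (by omega)
    have a5 := hinj y k (by omega) (by omega)
    have a6 : x = i → f x = f i := by rintro rfl; rfl
    have a7 : y = i → f y = f i := by rintro rfl; rfl
    simp only [s]
    split_ifs <;> omega
  have t_inj : ∀ x < q + 1, ∀ y < q + 1, t x = t y → x = y := by
    intro x hx y hy
    have a1 := hr (p + x)
    have a2 := hr (p + y)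
    have a3 := hinj (p + x) (p + y) (by omega) (by omega)
    have a4 := hinj (p + x) i (by omega) (by omega)
    have a5 := hinj (p + y) i (by omega) (by omega)
    have a6 : p + x = k → f (p + x) = f k := by intro h; rw [h]
    have a7 : p + y = k → f (p + y) = f k := by intro h; rw [h]
    simp only [t]
    split_ifs <;> omega
  refine ⟨permOfNatFun s s_lt s_inj, permOfNatFun t t_lt t_inj, ?_, ?_, ?_, ?_, ?_, ?_⟩
  · rw [avoids123_iff_natFun]
    intro x y z hxy hyz hz
    rw [natFun_permOfNatFun s_lt s_inj (by omega), natFun_permOfNatFun s_lt s_inj (by omega),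
      natFun_permOfNatFun s_lt s_inj hz, s_l x (by omega), s_l y (by omega)]
    intro hv hw
    rcases Nat.lt_or_ge z p with hzp | hzp
    · rw [s_l z hzp] at hw
      have := h6 x y z hxy hyz (by omega) (by omega) (by omega)
      omega
    · obtain rfl : z = p := by omega
      rw [s_p] at hw
      have := h6 x y k hxy (by omega) h3 (by omega) (by omega)
      omega
  · rw [natFun_permOfNatFun s_lt s_inj (by omega), s_p]
    omega
  · rw [avoids123_iff_natFun]
    intro x y z hxy hyz hz
    rw [natFun_permOfNatFun t_lt t_inj (by omega), natFun_permOfNatFun t_lt t_inj (by omega),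
      natFun_permOfNatFun t_lt t_inj hz, t_r y (by omega), t_r z (by omega)]
    intro hv hw
    rcases Nat.eq_zero_or_pos x with rfl | hx
    · rw [t_0] at hv
      have := h6 i (p + y) (p + z) (by omega) (by omega) (by omega) (by omega) (by omega)
      omega
    · rw [t_r x hx] at hv
      have := h6 (p + x) (p + y) (p + z) (by omega) (by omega) (by omega) (by omega) (by omega)
      omega
  · rw [natFun_permOfNatFun t_lt t_inj (by omega), t_0]
    omega
  · have := hr (p + 1) (by omega) (by omega) (by omega)
    rw [natFun_permOfNatFun t_lt t_inj (by omega), t_r 1 one_pos]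
    omega
  · intro x hx
    unfold glueFun
    rcases lt_trichotomy x p with hxp | rfl | hxp
    · have := hl x hxp
      have a6 : x = i → f x = f i := by rintro rfl; rfl
      rw [if_pos hxp, natFun_permOfNatFun t_lt t_inj (by omega),
        natFun_permOfNatFun s_lt s_inj (by omega), s_l x hxp, t_0]
      split_ifs <;> omega
    · rw [if_neg (lt_irrefl _), if_pos rfl, hm]
    · obtain ⟨y, rfl⟩ := Nat.exists_eq_add_of_le hxp.le
      have := hr (p + y) hxp hx
      have a6 : p + y = k → f (p + y) = f k := by intro h; rw [h]
      rw [if_neg (by omega), if_neg (by omega), Nat.add_sub_cancel_left,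
        natFun_permOfNatFun t_lt t_inj (by omega), natFun_permOfNatFun s_lt s_inj (by omega),
        t_r y (by omega), s_p]
      split_ifs <;> omega

end

open Classical in
theorem card_hasUniqueMiddle (p q : ℕ) :
    (Finset.univ.filter fun π : Equiv.Perm (Fin (p + q + 1)) => HasUniqueMiddle p π).card =
      (Finset.univ.filter fun σ : Equiv.Perm (Fin (p + 1)) =>
        Avoids123 σ ∧ natFun σ p ≠ 0).card *
      (Finset.univ.filter fun τ : Equiv.Perm (Fin (q + 1)) =>
        Avoids123 τ ∧ natFun τ 0 ≠ q ∧ natFun τ 1 ≠ q).card := by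
  rw [← Finset.card_product]
  symm
  have mem : ∀ x : Equiv.Perm (Fin (p + 1)) × Equiv.Perm (Fin (q + 1)),
      x ∈ (Finset.univ.filter fun σ : Equiv.Perm (Fin (p + 1)) =>
        Avoids123 σ ∧ natFun σ p ≠ 0) ×ˢ
      (Finset.univ.filter fun τ : Equiv.Perm (Fin (q + 1)) =>
        Avoids123 τ ∧ natFun τ 0 ≠ q ∧ natFun τ 1 ≠ q) ↔
      (Avoids123 x.1 ∧ natFun x.1 p ≠ 0) ∧
        Avoids123 x.2 ∧ natFun x.2 0 ≠ q ∧ natFun x.2 1 ≠ q := by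
    simp
  refine Finset.card_bij (fun x hx =>
    gluePerm x.1 x.2 ((mem x).1 hx).1.2 ((mem x).1 hx).2.2.1) ?_ ?_ ?_
  · rintro ⟨σ, τ⟩ hx
    obtain ⟨⟨h1, h2⟩, h3, h4, h5⟩ := (mem _).1 hx
    rw [Finset.mem_filter]
    refine ⟨Finset.mem_univ _, ?_⟩
    obtain ⟨i, hi, hi0⟩ := exists_natFun_eq σ (Nat.succ_pos p)
    obtain ⟨k, hk, hkq⟩ := exists_natFun_eq τ (Nat.lt_succ_self q)
    have key := isUniqueOccurrence_glueFun h2 h4 h1 h3 hi hi0 hk hkq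
    refine ⟨i, p + k, ?_, ?_⟩
    · intro h
      -- Adjacency of the last two entries would put the maximum of `τ` at position 1.
      obtain rfl : k = 1 := by omega
      exact h5 hkq
    · obtain ⟨k1, k2, k3, k4, k5, k6⟩ := key
      refine ⟨k1, k2, k3, ?_, ?_, ?_⟩
      · rwa [natFun_gluePerm _ _ (by omega), natFun_gluePerm _ _ (by omega)]
      · rwa [natFun_gluePerm _ _ (by omega), natFun_gluePerm _ _ (by omega)]
      · intro x y z hxy hyz hz
        rw [natFun_gluePerm _ _ (by omega), natFun_gluePerm _ _ (by omega),
          natFun_gluePerm _ _ (by omega)]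
        exact k6 x y z hxy hyz hz
  · rintro ⟨σ, τ⟩ hm ⟨σ', τ'⟩ hm' h
    have key : ∀ x < p + q + 1, glueFun p q (natFun σ) (natFun τ) x =
        glueFun p q (natFun σ') (natFun τ') x := by
      intro x hx
      have h1 := (mem _).1 hm
      have h2 := (mem _).1 hm'
      rw [← natFun_gluePerm h1.1.2 h1.2.2.1 hx, ← natFun_gluePerm h2.1.2 h2.2.2.1 hx]
      exact congrArg (fun ρ => natFun ρ x) h
    exact Prod.ext (glueFun_cancel key).1 (glueFun_cancel key).2
  · intro π hπ
    obtain ⟨i, k, hk, h⟩ := (Finset.mem_filter.1 hπ).2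
    obtain ⟨σ, τ, h1, h2, h3, h4, h5, h6⟩ := h.exists_glue hk
    refine ⟨(σ, τ), (mem _).2 ⟨⟨h1, h2⟩, h3, h4, h5⟩, perm_eq_of_natFun_eq fun x hx => ?_⟩
    rw [natFun_gluePerm _ _ hx, h6 x hx]

/-! ### Summation over the middle position. -/

theorem mem_occurrences123_iff_natFun {n : ℕ} (π : Equiv.Perm (Fin n)) (i j k : Fin n) :
    (i, j, k) ∈ occurrences123 π ↔ (i : ℕ) < j ∧ (j : ℕ) < k ∧
      natFun π i < natFun π j ∧ natFun π j < natFun π k := by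
  simp only [occurrences123, Finset.mem_filter, Finset.mem_univ, true_and, natFun_val, Fin.lt_def]

/-- Every 1-23 occurrence is a 1-2-3 occurrence, so only the unique one has to be checked for
adjacency. -/
theorem exists_hasUniqueMiddle_iff {n : ℕ} (π : Equiv.Perm (Fin n)) :
    ((occurrences123 π).card = 1 ∧ (occurrences1d23 π).card = 0) ↔
      ∃ p : Fin n, HasUniqueMiddle p π := by
  constructor
  · rintro ⟨h1, h2⟩
    obtain ⟨⟨i, j, k⟩, ht⟩ := Finset.card_eq_one.1 h1
    have hmem : (i, j, k) ∈ occurrences123 π := by rw [ht]; exact Finset.mem_singleton_self _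
    obtain ⟨a1, a2, a3, a4⟩ := (mem_occurrences123_iff_natFun π i j k).1 hmem
    refine ⟨j, i, k, fun hkj => ?_, a1, a2, k.2, a3, a4, fun x y z hxy hyz hz b1 b2 => ?_⟩
    · rw [Finset.card_eq_zero] at h2
      have : (i, j, k) ∈ occurrences1d23 π := by
        simp only [natFun_val] at a3 a4
        simp only [occurrences1d23, Finset.mem_filter, Finset.mem_univ, true_and]
        exact ⟨a1, hkj, a3, a4⟩
      rw [h2] at this
      exact absurd this (Finset.notMem_empty _)
    · have : ((⟨x, by omega⟩, ⟨y, by omega⟩, ⟨z, hz⟩) : Fin n × Fin n × Fin n) ∈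
          occurrences123 π := (mem_occurrences123_iff_natFun π _ _ _).2 ⟨hxy, hyz, b1, b2⟩
      rw [ht, Finset.mem_singleton] at this
      simpa [Fin.ext_iff] using this
  · rintro ⟨p, i, k, hk, h1, h2, h3, h4, h5, h6⟩
    have hocc : occurrences123 π = {(⟨i, by omega⟩, p, ⟨k, h3⟩)} := by
      ext ⟨x, y, z⟩
      rw [mem_occurrences123_iff_natFun, Finset.mem_singleton]
      constructor
      · rintro ⟨b1, b2, b3, b4⟩
        simpa [Fin.ext_iff] using h6 x y z b1 b2 z.2 b3 b4
      · intro h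
        simp only [Prod.mk.injEq] at h
        obtain ⟨rfl, rfl, rfl⟩ := h
        exact ⟨h1, h2, h4, h5⟩
    refine ⟨by rw [hocc, Finset.card_singleton], ?_⟩
    rw [Finset.card_eq_zero, Finset.eq_empty_iff_forall_notMem]
    rintro ⟨x, y, z⟩ hx
    simp only [occurrences1d23, Finset.mem_filter, Finset.mem_univ, true_and] at hx
    obtain ⟨b1, b2, b3, b4⟩ := hx
    have := h6 x y z b1 (by omega) z.2 (by simpa only [natFun_val, Fin.lt_def] using b3)
      (by simpa only [natFun_val, Fin.lt_def] using b4)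
    omega

theorem HasUniqueMiddle.eq {n p p' : ℕ} {π : Equiv.Perm (Fin n)} (h : HasUniqueMiddle p π)
    (h' : HasUniqueMiddle p' π) : p = p' := by
  obtain ⟨i, k, -, h1, h2, h3, h4, h5, -⟩ := h
  obtain ⟨i', k', -, -, -, -, -, -, h6⟩ := h'
  exact (h6 i p k h1 h2 h3 h4 h5).2.1

open Classical in
theorem dCount_eq_sum (n : ℕ) : dCount n = ∑ p ∈ Finset.range n,
    (Finset.univ.filter fun π : Equiv.Perm (Fin n) => HasUniqueMiddle p π).card := by
  rw [← Finset.card_biUnion]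
  · rw [dCount]
    congr 1
    ext π
    rw [Finset.mem_filter, exists_hasUniqueMiddle_iff]
    simp [Fin.exists_iff]
  · intro p _ p' _ hpp'
    rw [Function.onFun, Finset.disjoint_filter]
    exact fun π _ h h' => hpp' (h.eq h')

open Classical in
theorem card_avoids123_natFun_last_ne (p : ℕ) :
    ((Finset.univ.filter fun σ : Equiv.Perm (Fin (p + 1)) =>
      Avoids123 σ ∧ natFun σ p ≠ 0).card : ℚ) =
      PowerSeries.coeff p (PowerSeries.X * catalanGF ^ 3) := by
  rw [← card_avoids123_last_ne_zero]
  congr 2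
  ext σ
  have : natFun σ p = σ (Fin.last p) := natFun_val σ (Fin.last p)
  simp [this]

open Classical in
theorem card_avoids123_natFun_first_second_ne (q : ℕ) :
    ((Finset.univ.filter fun τ : Equiv.Perm (Fin (q + 1)) =>
      Avoids123 τ ∧ natFun τ 0 ≠ q ∧ natFun τ 1 ≠ q).card : ℚ) =
      PowerSeries.coeff q (PowerSeries.X ^ 2 * catalanGF ^ 4) := by
  rw [← card_avoids123_le_symm_last q 2]
  congr 2
  ext τ
  simp only [Finset.mem_filter, Finset.mem_univ, true_and, and_congr_right_iff]
  intro _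
  obtain ⟨m, hm⟩ : ∃ m, m = τ.symm (Fin.last q) := ⟨_, rfl⟩
  have hmq : natFun τ m = q := by rw [natFun_val, hm]; simp
  rw [← hm]
  constructor
  · rintro ⟨h0, h1⟩
    have a0 : (m : ℕ) ≠ 0 := fun h => h0 ((congrArg (natFun τ) h.symm).trans hmq)
    have a1 : (m : ℕ) ≠ 1 := fun h => h1 ((congrArg (natFun τ) h.symm).trans hmq)
    omega
  · intro h
    have := m.2
    refine ⟨fun h0 => ?_, fun h1 => ?_⟩
    · have := natFun_inj τ (Nat.succ_pos q) m.2 (h0.trans hmq.symm)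
      omega
    · have := natFun_inj τ (show 1 < q + 1 by omega) m.2 (h1.trans hmq.symm)
      omega

/-- With `p + q = n`, the sum over middle positions is the Cauchy product of the two counting
series. -/
theorem dCount_succ_eq_coeff (n : ℕ) :
    (dCount (n + 1) : ℚ) = PowerSeries.coeff n (PowerSeries.X ^ 3 * catalanGF ^ 7) := by
  classical
  rw [show (PowerSeries.X ^ 3 * catalanGF ^ 7 : PowerSeries ℚ) =
      (PowerSeries.X * catalanGF ^ 3) * (PowerSeries.X ^ 2 * catalanGF ^ 4) by ring,
    PowerSeries.coeff_mul, dCount_eq_sum, Nat.cast_sum,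
    Finset.Nat.sum_antidiagonal_eq_sum_range_succ_mk]
  refine Finset.sum_congr rfl fun p hp => ?_
  obtain ⟨q, rfl⟩ := Nat.exists_eq_add_of_le (Nat.lt_succ_iff.1 (Finset.mem_range.1 hp))
  rw [card_hasUniqueMiddle, Nat.cast_mul, card_avoids123_natFun_last_ne, Nat.add_sub_cancel_left,
    card_avoids123_natFun_first_second_ne]

theorem mk_dCount_eq :
    PowerSeries.mk (fun n : ℕ => (dCount n : ℚ)) = PowerSeries.X ^ 4 * catalanGF ^ 7 := by
  ext n
  rw [PowerSeries.coeff_mk]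
  cases n with
  | zero => simp [dCount_eq_sum]
  | succ n =>
    rw [dCount_succ_eq_coeff, pow_succ' PowerSeries.X 3, mul_assoc, PowerSeries.coeff_succ_X_mul]

theorem theorem10 :
    PowerSeries.mk (fun n : ℕ => (dCount n : ℚ)) = PowerSeries.X ^ 4 * catalanGF ^ 7 ∧
    ∀ n : ℕ, 1 ≤ n →
      (dCount n : ℚ) = 7 / ((n : ℚ) + 3) * ((2 * n - 2).choose (n + 2) : ℚ) := by
  refine ⟨mk_dCount_eq, fun n hn => ?_⟩
  rw [← coeff_X_pow_four_mul_catalanGF_pow_seven hn, ← mk_dCount_eq, PowerSeries.coeff_mk]
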